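/- Let $H_A$ and $H_B$ be separable (possibly infinite-dimensional) complex Hilbert spaces and let $H_A\otimes H_B$ be their Hilbert space tensor product. Fix an orthonormal basis $(f_i)_i$ of $H_B$. Every $\psi\in H_A\otimes H_B$ has an expansion $\psi=\sum_i\varphi_i\otimes f_i$ with $\varphi_i\in H_A$ and $\sum_i\|\varphi_i\|^2=\|\psi\|^2$; the operator associated with $\psi$ is the bounded operator $X:H_B\to H_A$, $X\eta=\sum_i\langle f_i,\eta\rangle\,\varphi_i$. For orthonormal vectors $\psi_1,\dots,\psi_M\in H_A\otimes H_B$ with associated operators $X_1,\dots,X_M$, let $\mathcal K$ be the real vector space of trace-class self-adjoint operators on $H_B$ spanned by the operators $X_m^*X_l+X_l^*X_m$ and $i(X_m^*X_l-X_l^*X_m)$ with $1\le m,l\le M$, $m\neq l$. An LOCC protocol consists of finitely many rounds. In each round one of the two parties performs a measurement with countably many outcomes on the local system, described by bounded operators $(K_j)_j$ from the local Hilbert space to some Hilbert space with $\sum_jK_j^*K_j=1$ (weakly), and communicates the outcome to the other party; the continuation may depend on all outcomes so far. At the end the parties announce a guess in $\{1,\dots,M\}$. The probability of a sequence of outcomes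 on the state $\psi$ is $\|K\psi\|^2$, where $K$ is the product of the corresponding operators $K_j\otimes 1$ and $1\otimes K_j$. The states $\psi_1,\dots,\psi_M$ are distinguishable by LOCC with certainty if there is an LOCC protocol that, for every $l$, announces $l$ with probability $1$ when it is run on $\psi_l$. **Theorem.** Let $\psi_1,\dots,\psi_M$ be orthonormal vectors in $H_A\otimes H_B$, and let $\mathcal K$ be the associated real vector space (with respect to any orthonormal basis of $H_B$). If $\dim_{\mathbb R}\mathcal K=2$, then $\psi_1,\dots,\psi_M$ are distinguishable by LOCC with certainty. In particular, any two orthonormal vectors $\psi_1,\psi_2\in H_A\otimes H_B$ are distinguishable by LOCC with certainty (whatever the dimension of the associated $\mathcal K$). -/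

import Mathlib

open scoped TensorProduct ENNReal InnerProductSpace

universe u v

noncomputable section

namespace LocalDiscrimination

section Tensor

/-- The Hilbert space tensor product of `A` and `B`: the completion of the algebraic tensor product
for the inner product with `⟪a ⊗ b, a' ⊗ b'⟫ = ⟪a, a'⟫ * ⟪b, b'⟫`. -/
abbrev HilbertTensor (A : Type u) (B : Type v)
    [NormedAddCommGroup A] [InnerProductSpace ℂ A]
    [NormedAddCommGroup B] [InnerProductSpace ℂ B] : Type (max u v) :=
  UniformSpace.Completion (A ⊗[ℂ] B)

variable {A A' : Type u} {B B' : Type v}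
  [NormedAddCommGroup A] [InnerProductSpace ℂ A]
  [NormedAddCommGroup A'] [InnerProductSpace ℂ A']
  [NormedAddCommGroup B] [InnerProductSpace ℂ B]
  [NormedAddCommGroup B'] [InnerProductSpace ℂ B']

/-- The bounded operator `K ⊗ 1`. -/
def onLeft (K : A →L[ℂ] A') : HilbertTensor A B →L[ℂ] HilbertTensor A' B :=
  (TensorProduct.mapL K (ContinuousLinearMap.id ℂ B)).completion

/-- The bounded operator `1 ⊗ K`. -/
def onRight (K : B →L[ℂ] B') : HilbertTensor A B →L[ℂ] HilbertTensor A B' :=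
  (TensorProduct.mapL (ContinuousLinearMap.id ℂ A) K).completion

/-- The bounded operator `a ↦ a ⊗ b`. -/
def tensorRight (A : Type u) [NormedAddCommGroup A] [InnerProductSpace ℂ A] (b : B) :
    A →L[ℂ] HilbertTensor A B :=
  UniformSpace.Completion.toComplL ∘L (TensorProduct.mkL ℂ A B).flip b

theorem tensorRight_apply (a : A) (b : B) :
    tensorRight A b a = ((a ⊗ₜ[ℂ] b : A ⊗[ℂ] B) : HilbertTensor A B) := rfl

end Tensor

section Operators

variable {A : Type u} {B : Type v}
  [NormedAddCommGroup A] [InnerProductSpace ℂ A] [CompleteSpace A]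
  [NormedAddCommGroup B] [InnerProductSpace ℂ B]

/-- The partial inner product `(1 ⊗ ⟨b|) ψ`, an element of `A`. If `f` is an orthonormal basis
of `B`, then `coeff (f i) ψ` is the vector `φ i` of the expansion `ψ = ∑ i, φ i ⊗ f i`. -/
def coeff (b : B) (ψ : HilbertTensor A B) : A :=
  ContinuousLinearMap.adjoint (tensorRight A b) ψ

theorem inner_tensorRight (a : A) (b : B) (ψ : HilbertTensor A B) :
    ⟪tensorRight A b a, ψ⟫_ℂ = ⟪a, coeff b ψ⟫_ℂ :=
  (ContinuousLinearMap.adjoint_inner_right _ _ _).symm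

theorem sum_norm_coeff_sq_le {ι : Type*} (f : HilbertBasis ι ℂ B) (ψ : HilbertTensor A B)
    (s : Finset ι) : ∑ i ∈ s, ‖coeff (f i) ψ‖ ^ 2 ≤ ‖ψ‖ ^ 2 := by
  classical
  set y : HilbertTensor A B := ∑ i ∈ s, tensorRight A (f i) (coeff (f i) ψ) with hy
  have h1 : ⟪y, ψ⟫_ℂ = ((∑ i ∈ s, ‖coeff (f i) ψ‖ ^ 2 : ℝ) : ℂ) := by
    rw [hy, sum_inner]
    push_cast
    refine Finset.sum_congr rfl fun i _ => ?_
    rw [inner_tensorRight, inner_self_eq_norm_sq_to_K]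
    rfl
  have h2 : ⟪y, y⟫_ℂ = ((∑ i ∈ s, ‖coeff (f i) ψ‖ ^ 2 : ℝ) : ℂ) := by
    conv_lhs => rw [hy]
    rw [sum_inner]
    push_cast
    refine Finset.sum_congr rfl fun i hi => ?_
    rw [inner_sum, Finset.sum_eq_single i]
    · rw [tensorRight_apply, UniformSpace.Completion.inner_coe, TensorProduct.inner_tmul,
        inner_self_eq_norm_sq_to_K, inner_self_eq_norm_sq_to_K, f.orthonormal.1 i]
      simp
    · intro j _ hj
      rw [tensorRight_apply, tensorRight_apply, UniformSpace.Completion.inner_coe,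
        TensorProduct.inner_tmul, f.orthonormal.2 hj.symm, mul_zero]
    · exact fun h => absurd hi h
  have h3 : ‖y‖ ^ 2 = ∑ i ∈ s, ‖coeff (f i) ψ‖ ^ 2 := by
    apply Complex.ofReal_injective
    rw [← h2, inner_self_eq_norm_sq_to_K]
    push_cast
    rfl
  have h4 : ∑ i ∈ s, ‖coeff (f i) ψ‖ ^ 2 ≤ ‖y‖ * ‖ψ‖ := by
    have h := norm_inner_le_norm (𝕜 := ℂ) y ψ
    rw [h1, Complex.norm_real] at h
    exact (le_abs_self _).trans h
  nlinarith [sq_nonneg (‖y‖ - ‖ψ‖), norm_nonneg y, norm_nonneg ψ]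

theorem sum_norm_smul_coeff_le {ι : Type*} (f : HilbertBasis ι ℂ B) (ψ : HilbertTensor A B)
    (η : B) (s : Finset ι) : ∑ i ∈ s, ‖⟪f i, η⟫_ℂ • coeff (f i) ψ‖ ≤ ‖ψ‖ * ‖η‖ := by
  have h1 : ∑ i ∈ s, ‖⟪f i, η⟫_ℂ‖ ^ 2 ≤ ‖η‖ ^ 2 := f.orthonormal.sum_inner_products_le η
  have h2 := sum_norm_coeff_sq_le f ψ s
  have h3 := Finset.sum_mul_sq_le_sq_mul_sq s (fun i => ‖⟪f i, η⟫_ℂ‖)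
    (fun i => ‖coeff (f i) ψ‖)
  simp_rw [norm_smul]
  refine abs_le_of_sq_le_sq' ?_ (by positivity) |>.2
  calc _ ≤ _ := h3
    _ ≤ ‖η‖ ^ 2 * ‖ψ‖ ^ 2 := by gcongr
    _ = _ := by ring

theorem summable_smul_coeff {ι : Type*} (f : HilbertBasis ι ℂ B) (ψ : HilbertTensor A B)
    (η : B) : Summable fun i => ⟪f i, η⟫_ℂ • coeff (f i) ψ :=
  (summable_of_sum_le (fun _ => norm_nonneg _) (sum_norm_smul_coeff_le f ψ η)).of_norm

/-- The bounded operator `X : B → A`, `X η = ∑ i, ⟪f i, η⟫ • φ i`, associated with the vector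
`ψ = ∑ i, φ i ⊗ f i` through the orthonormal basis `f` of `B`. -/
def operatorOf {ι : Type*} (f : HilbertBasis ι ℂ B) (ψ : HilbertTensor A B) : B →L[ℂ] A :=
  LinearMap.mkContinuous
    { toFun := fun η => ∑' i, ⟪f i, η⟫_ℂ • coeff (f i) ψ
      map_add' := fun η ζ => by
        simp_rw [inner_add_right, add_smul]
        exact (summable_smul_coeff f ψ η).tsum_add (summable_smul_coeff f ψ ζ)
      map_smul' := fun c η => by
        simp_rw [inner_smul_right, mul_smul]
        exact (summable_smul_coeff f ψ η).tsum_const_smul c }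
    ‖ψ‖ fun η => by
      have hs : Summable fun i => ‖⟪f i, η⟫_ℂ • coeff (f i) ψ‖ :=
        summable_of_sum_le (fun _ => norm_nonneg _) (sum_norm_smul_coeff_le f ψ η)
      exact (norm_tsum_le_tsum_norm hs).trans
        (hs.tsum_le_of_sum_le (sum_norm_smul_coeff_le f ψ η))

/-- The real vector space `𝒦` of (trace class, self-adjoint) operators on `B` associated with
vectors `ψ 1, …, ψ M`: the real span of the operators `(X m)† (X l) + (X l)† (X m)` and
`i ((X m)† (X l) - (X l)† (X m))` for `m ≠ l`, where `X l` is the operator associated with `ψ l`.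
Self-adjointness is evident, and these operators are trace class because each `X l` is
Hilbert–Schmidt. -/
def associatedSpace [CompleteSpace B] {ι : Type*} (f : HilbertBasis ι ℂ B) {M : ℕ}
    (ψ : Fin M → HilbertTensor A B) : Submodule ℝ (B →L[ℂ] B) :=
  let X : Fin M → B →L[ℂ] A := fun l => operatorOf f (ψ l)
  let T : Fin M → Fin M → B →L[ℂ] B := fun m l => ContinuousLinearMap.adjoint (X m) ∘L X l
  Submodule.span ℝ
    {S | ∃ m l : Fin M, m ≠ l ∧ (S = T m l + T l m ∨ S = Complex.I • (T m l - T l m))}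

end Operators

section Protocols

/-- The measurement operators `K i` of a local measurement with outcomes `i`:
`∑ i, (K i)† (K i) = 1` (weakly). -/
def IsMeasurement {ι : Type} {H H' : Type*}
    [NormedAddCommGroup H] [InnerProductSpace ℂ H]
    [NormedAddCommGroup H'] [InnerProductSpace ℂ H'] (K : ι → H →L[ℂ] H') : Prop :=
  ∀ x y : H, HasSum (fun i => ⟪K i x, K i y⟫_ℂ) ⟪x, y⟫_ℂ

/-- An LOCC discrimination protocol with at most `r` rounds for two parties holding `A` and `B`,
ending in a guess in `Fin M`. Either the parties stop and announce a guess, or one of them performs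
a measurement with countably many outcomes on the local system and communicates the outcome `i` to
the other one, after which they go on with a protocol that may depend on `i`. The measurement
operators may map to another Hilbert space, so that local isometries, ancillas, discarding of
subsystems and local randomness are included. -/
inductive LOCC (M : ℕ) : ℕ → (A : Type u) → (B : Type v) →
    [NormedAddCommGroup A] → [InnerProductSpace ℂ A] → [CompleteSpace A] →
    [NormedAddCommGroup B] → [InnerProductSpace ℂ B] → [CompleteSpace B] → Type (max u v + 1)
  | guess {r : ℕ} {A : Type u} {B : Type v}
      [NormedAddCommGroup A] [InnerProductSpace ℂ A] [CompleteSpace A]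
      [NormedAddCommGroup B] [InnerProductSpace ℂ B] [CompleteSpace B]
      (l : Fin M) : LOCC M r A B
  | alice {r : ℕ} {A A' : Type u} {B : Type v}
      [NormedAddCommGroup A] [InnerProductSpace ℂ A] [CompleteSpace A]
      [NormedAddCommGroup A'] [InnerProductSpace ℂ A'] [CompleteSpace A']
      [NormedAddCommGroup B] [InnerProductSpace ℂ B] [CompleteSpace B]
      {ι : Type} (hι : Countable ι) (K : ι → A →L[ℂ] A') (hK : IsMeasurement K)
      (next : ι → LOCC M r A' B) : LOCC M (r + 1) A B
  | bob {r : ℕ} {A : Type u} {B B' : Type v}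
      [NormedAddCommGroup A] [InnerProductSpace ℂ A] [CompleteSpace A]
      [NormedAddCommGroup B] [InnerProductSpace ℂ B] [CompleteSpace B]
      [NormedAddCommGroup B'] [InnerProductSpace ℂ B'] [CompleteSpace B']
      {ι : Type} (hι : Countable ι) (K : ι → B →L[ℂ] B') (hK : IsMeasurement K)
      (next : ι → LOCC M r A B') : LOCC M (r + 1) A B

/-- The probability that the protocol ends with the guess `m` when it is run on the pure state `ψ`.
An outcome `i` with measurement operator `K i` turns the (unnormalized) vector `ψ` into
`(K i ⊗ 1) ψ` or `(1 ⊗ K i) ψ`; the probability of a sequence of outcomes is the squared norm of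
the resulting vector. -/
def LOCC.prob {M r : ℕ} {A : Type u} {B : Type v}
    [NormedAddCommGroup A] [InnerProductSpace ℂ A] [CompleteSpace A]
    [NormedAddCommGroup B] [InnerProductSpace ℂ B] [CompleteSpace B]
    (P : LOCC M r A B) (ψ : HilbertTensor A B) (m : Fin M) : ℝ≥0∞ :=
  match P with
  | .guess l => if m = l then ENNReal.ofReal (‖ψ‖ ^ 2) else 0
  | @LOCC.alice _ _ _ _ _ _ _ _ _ _ _ _ _ _ _ _ K _ next =>
      ∑' i, (next i).prob (onLeft (K i) ψ) m
  | @LOCC.bob _ _ _ _ _ _ _ _ _ _ _ _ _ _ _ _ K _ next =>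
      ∑' i, (next i).prob (onRight (K i) ψ) m

/-- The states `ψ 1, …, ψ M` can be distinguished by LOCC with certainty: there is an LOCC
protocol (with finitely many rounds) which, run on `ψ l`, announces `l` with probability `1` and
any other guess with probability `0`, for every `l`. -/
def DistinguishableByLOCC {A : Type u} {B : Type v}
    [NormedAddCommGroup A] [InnerProductSpace ℂ A] [CompleteSpace A]
    [NormedAddCommGroup B] [InnerProductSpace ℂ B] [CompleteSpace B] {M : ℕ}
    (ψ : Fin M → HilbertTensor A B) : Prop :=
  ∃ (r : ℕ) (P : LOCC M r A B), ∀ l m : Fin M, P.prob (ψ l) m = if m = l then 1 else 0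

end Protocols

end LocalDiscrimination

end

/-! If Bob measures in an orthonormal basis, outcome `b'` leaves Alice with the vectors `coeff b' (ψ
l)`. When these are pairwise orthogonal, one measurement by Alice identifies `l`. If `b'` is the
conjugate of `b`, their inner products are `⟪b, X_m† X_l b⟫`. So it suffices to find an orthonormal
basis in which every `X_m† X_l`, `m ≠ l`, has zero diagonal. In every basis such a diagonal sums to
`⟪ψ m, ψ l⟫ = 0`.

One operator suffices. If `S`, `T` is a basis of the associated space, the forms of `S` and `T` are
real, so the form of `Z = S + iT` vanishes only where both do. For two states, `Z = X_0† X_1` serves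
directly.

It remains to give a trace-zero `Z` a basis with zero diagonal
(`exists_hilbertBasis_zero_diagonal`). Take a maximal orthonormal set on which the form vanishes and
complete it to a basis. The new diagonal entries sum to zero and lie in the numerical range of `Z`
on the orthogonal complement, which is convex by Toeplitz–Hausdorff (`convex_numericalRange`). A
convex set in finite dimension, closed or not, contains the sum of such a series when that sum is
zero (`zero_mem_of_hasSum_zero`). Hence if anything had been added, the maximal set could be
enlarged. -/

noncomputable section

namespace LocalDiscrimination

/-! ### Convex sets and series with sum zero. -/

section ConvexSums

/-- Without interior points, `C` lies in a proper affine subspace. A functional killing its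
direction is constant on `C`, and its sign can be chosen. -/
theorem exists_ne_zero_nonneg_of_zero_notMem {V : Type*} [NormedAddCommGroup V] [NormedSpace ℝ V]
    [FiniteDimensional ℝ V] {C : Set V} (hC : Convex ℝ C) (hne : C.Nonempty) (h0 : (0 : V) ∉ C) :
    ∃ f : V →ₗ[ℝ] ℝ, f ≠ 0 ∧ ∀ x ∈ C, 0 ≤ f x := by
  by_cases hint : (interior C).Nonempty
  · obtain ⟨f, hf, hfC⟩ := geometric_hahn_banach_of_nonempty_interior_point hC
      (fun h => h0 (interior_subset h)) hint
    refine ⟨-(f : V →ₗ[ℝ] ℝ), ?_, fun x hx => ?_⟩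
    · intro h
      apply hf
      ext x
      simpa using congrArg (fun g : V →ₗ[ℝ] ℝ => g x) h
    · simpa using hfC x hx
  · rw [hC.interior_nonempty_iff_affineSpan_eq_top,
      AffineSubspace.affineSpan_eq_top_iff_vectorSpan_eq_top_of_nonempty ℝ V V hne] at hint
    obtain ⟨f, hf, hker⟩ := Submodule.exists_le_ker_of_lt_top _ (lt_top_iff_ne_top.mpr hint)
    obtain ⟨c, hc⟩ := hne
    have hconst : ∀ x ∈ C, f x = f c := fun x hx => by
      have := hker (vsub_mem_vectorSpan ℝ hx hc)
      rwa [LinearMap.mem_ker, vsub_eq_sub, map_sub, sub_eq_zero] at this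
    rcases le_total 0 (f c) with h | h
    · exact ⟨f, hf, fun x hx => (hconst x hx).symm ▸ h⟩
    · refine ⟨-f, neg_ne_zero.mpr hf, fun x hx => ?_⟩
      rw [LinearMap.neg_apply, hconst x hx]
      exact neg_nonneg.mpr h

/-- A convex subset of a finite-dimensional space (closed or not) which contains the terms of a
nonempty convergent series with sum zero contains zero. -/
theorem zero_mem_of_hasSum_zero {I : Type*} [Nonempty I] (n : ℕ) :
    ∀ (V : Type u) [NormedAddCommGroup V] [NormedSpace ℝ V] [FiniteDimensional ℝ V],
      Module.finrank ℝ V = n → ∀ (C : Set V), Convex ℝ C → ∀ z : I → V, (∀ i, z i ∈ C) →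
      HasSum z 0 → (0 : V) ∈ C := by
  induction n using Nat.strong_induction_on with
  | _ n ih =>
    intro V _ _ _ hn C hC z hz hsum
    by_contra h0
    obtain ⟨i₀⟩ := ‹Nonempty I›
    -- The values `f (z i)` are nonnegative with sum zero, so every `z i` lies in `ker f`. Its
    -- dimension is smaller, and induction applies to `C ∩ ker f`.
    obtain ⟨f, hf, hfC⟩ := exists_ne_zero_nonneg_of_zero_notMem hC ⟨_, hz i₀⟩ h0
    have hfsum : HasSum (fun i => f (z i)) 0 := by
      have := hsum.mapL (LinearMap.toContinuousLinearMap f)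
      simpa using this
    have hker : ∀ i, z i ∈ LinearMap.ker f := fun i =>
      congrFun ((hasSum_zero_iff_of_nonneg fun i => hfC _ (hz i)).mp hfsum) i
    have hlt : Module.finrank ℝ (LinearMap.ker f) < n := by
      rw [← hn]
      apply Submodule.finrank_lt
      rw [Ne, LinearMap.ker_eq_top]
      exact hf
    have hsum' : HasSum (fun i => (⟨z i, hker i⟩ : LinearMap.ker f)) 0 :=
      (Topology.IsInducing.hasSum_iff (g := (LinearMap.ker f).subtype)
        Topology.IsInducing.subtypeVal _ _).mp hsum
    exact h0 (ih _ hlt (LinearMap.ker f) rfl ((LinearMap.ker f).subtype ⁻¹' C)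
      (hC.linear_preimage (LinearMap.ker f).subtype) _ hz hsum')

end ConvexSums

/-! ### Convexity of the numerical range. -/

section NumericalRange

variable {H : Type*} [NormedAddCommGroup H] [InnerProductSpace ℂ H]

/-- Since `Im (c̄ r) = -Im (c r̄)`, the imaginary part is that of `c (p - r̄)`, which vanishes once
`c` cancels the phase of `p - r̄`. -/
theorem exists_norm_eq_one_im_eq_zero (p r : ℂ) :
    ∃ c : ℂ, ‖c‖ = 1 ∧ (c * p + star c * r).im = 0 := by
  by_cases h : p - star r = 0
  · refine ⟨1, by simp, ?_⟩
    have := congrArg Complex.im h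
    simp at this ⊢
    linarith
  · refine ⟨star (p - star r) / ‖p - star r‖, ?_, ?_⟩
    · rw [norm_div, norm_star, Complex.norm_real, norm_norm, div_self (norm_ne_zero_iff.mpr h)]
    · rw [star_div₀]
      simp only [Complex.star_def, Complex.conj_ofReal, map_sub, Complex.conj_conj]
      rw [div_mul_eq_mul_div, div_mul_eq_mul_div, ← add_div, Complex.div_ofReal_im]
      simp
      left
      ring

/-- The **Toeplitz–Hausdorff theorem**: the numerical range of (the compression to a subspace of)
an operator is convex. -/
theorem convex_numericalRange (Z : H →L[ℂ] H) (W : Submodule ℂ H) :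
    Convex ℝ {z : ℂ | ∃ w ∈ W, ‖w‖ = 1 ∧ ⟪w, Z w⟫_ℂ = z} := by
  rintro a ⟨x, hxW, hx, hxa⟩ b ⟨y, hyW, hy, hyb⟩ t' t ht' ht htt
  by_cases hab : a = b
  · refine ⟨x, hxW, hx, ?_⟩
    rw [hxa, ← hab, ← add_smul, htt, one_smul]
  have hba : b - a ≠ 0 := sub_ne_zero.mpr (Ne.symm hab)
  -- After the affine change sending `a` to 0 and `b` to 1, the phase `c` makes the cross terms
  -- between `x` and `c • y` real. The form then stays on the line through `a` and `b` along the
  -- path `w`.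
  obtain ⟨c, hc, him⟩ := exists_norm_eq_one_im_eq_zero
    ((⟪x, Z y⟫_ℂ - a * ⟪x, y⟫_ℂ) / (b - a)) ((⟪y, Z x⟫_ℂ - a * ⟪y, x⟫_ℂ) / (b - a))
  set k : ℂ := c * ((⟪x, Z y⟫_ℂ - a * ⟪x, y⟫_ℂ) / (b - a)) +
    star c * ((⟪y, Z x⟫_ℂ - a * ⟪y, x⟫_ℂ) / (b - a)) with hk
  have hkre : (k.re : ℂ) = k := Complex.ext rfl (by simpa using him.symm)
  have hkba : k * (b - a) = c * (⟪x, Z y⟫_ℂ - a * ⟪x, y⟫_ℂ) +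
      star c * (⟪y, Z x⟫_ℂ - a * ⟪y, x⟫_ℂ) := by
    rw [hk]
    field_simp
  have hcc : star c * c = 1 := by
    have h := Complex.conj_mul' c
    rw [hc] at h
    simpa using h
  have hxx : ⟪x, x⟫_ℂ = 1 := by rw [inner_self_eq_norm_sq_to_K, hx]; simp
  have hyy : ⟪y, y⟫_ℂ = 1 := by rw [inner_self_eq_norm_sq_to_K, hy]; simp
  let w : ℝ → H := fun s => ((1 - s : ℝ) : ℂ) • x + ((s : ℂ) * c) • y
  have hw : ∀ s : ℝ, ⟪w s, Z (w s)⟫_ℂ - a * ⟪w s, w s⟫_ℂ =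
      (b - a) * (((1 - s) * s * k.re + s ^ 2 : ℝ) : ℂ) := fun s => by
    have h1 : (b - a) * (((1 - s) * s * k.re + s ^ 2 : ℝ) : ℂ) =
        (1 - s) * s * (k * (b - a)) + s ^ 2 * (b - a) := by
      push_cast
      rw [hkre]
      ring
    rw [h1, hkba]
    simp only [w, map_add, map_smul, inner_add_left, inner_add_right, inner_smul_left,
      inner_smul_right, hxx, hyy, hxa, hyb, map_mul, Complex.conj_ofReal, Complex.star_def] at hcc ⊢
    push_cast
    linear_combination (s ^ 2 * (b - a)) * hcc
  -- A zero of this function is a parameter where the Rayleigh quotient of `w s` is `a + t (b - a)`;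
  -- the intermediate value theorem provides one.
  have hcont : Continuous fun s : ℝ => (1 - s) * s * k.re + s ^ 2 - t * ‖w s‖ ^ 2 := by
    fun_prop
  have h0 : (1 - 0 : ℝ) * 0 * k.re + 0 ^ 2 - t * ‖w 0‖ ^ 2 ≤ 0 := by
    simp [w, hx, ht]
  have h1 : 0 ≤ (1 - 1 : ℝ) * 1 * k.re + 1 ^ 2 - t * ‖w 1‖ ^ 2 := by
    simp [w, hy, norm_smul, hc]
    linarith
  obtain ⟨s, ⟨hs0, hs1⟩, hs⟩ := intermediate_value_Icc zero_le_one hcont.continuousOn ⟨h0, h1⟩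
  -- If `w s = 0`, comparing norms gives `s = 1/2`, so `x = -c • y` and hence `a = b`.
  have hws : w s ≠ 0 := fun h => by
    have hxy : ((1 - s : ℝ) : ℂ) • x = -(((s : ℂ) * c) • y) := eq_neg_of_add_eq_zero_left h
    have hn := congrArg norm hxy
    rw [norm_neg, norm_smul, norm_smul, norm_mul, Complex.norm_real, Complex.norm_real, hx, hy, hc,
      Real.norm_of_nonneg (by linarith), Real.norm_of_nonneg hs0] at hn
    have hs2 : s = 1 / 2 := by linarith
    subst hs2
    have hxy' : x = -(c • y) := by
      have h2 := congrArg (fun v => (2 : ℂ) • v) hxy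
      simp only [smul_neg, smul_smul] at h2
      convert h2 using 1
      · norm_num
      · congr 2
        push_cast
        ring
    apply hab
    rw [← hxa, ← hyb, hxy', map_neg, inner_neg_neg, map_smul, inner_smul_left, inner_smul_right,
      ← mul_assoc, ← Complex.star_def, hcc, one_mul]
  have hnw : ((‖w s‖ : ℝ) : ℂ) ≠ 0 := by exact_mod_cast norm_ne_zero_iff.mpr hws
  refine ⟨((‖w s‖ : ℂ)⁻¹) • w s, W.smul_mem _ (W.add_mem (W.smul_mem _ hxW) (W.smul_mem _ hyW)),
    ?_, ?_⟩
  · rw [norm_smul, norm_inv, Complex.norm_real, norm_norm,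
      inv_mul_cancel₀ (norm_ne_zero_iff.mpr hws)]
  · have h2 := hw s
    have h3 : (1 - s) * s * k.re + s ^ 2 = t * ‖w s‖ ^ 2 := by
      have := hs
      simp only at this
      linarith
    have h4 : ⟪w s, w s⟫_ℂ = (‖w s‖ : ℂ) ^ 2 := inner_self_eq_norm_sq_to_K _
    rw [h3, h4] at h2
    rw [map_smul, inner_smul_left, inner_smul_right, eq_add_of_sub_eq h2]
    simp only [map_inv₀, Complex.conj_ofReal, Complex.real_smul]
    have h5 : (t' : ℂ) = 1 - t := by rw [eq_sub_iff_add_eq]; exact_mod_cast htt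
    rw [h5]
    push_cast
    field_simp
    ring

end NumericalRange

/-! ### Orthonormal bases with vanishing diagonal. -/

section ZeroDiagonal

variable {H : Type u} [NormedAddCommGroup H] [InnerProductSpace ℂ H] [CompleteSpace H]

/-- An operator with trace zero (computed in any orthonormal basis) has an orthonormal basis in which
its diagonal vanishes. -/
theorem exists_hilbertBasis_zero_diagonal (Z : H →L[ℂ] H)
    (hZ : ∀ (s : Set H) (b : HilbertBasis s ℂ H), HasSum (fun i => ⟪b i, Z (b i)⟫_ℂ) 0) :
    ∃ (s : Set H) (b : HilbertBasis s ℂ H), ∀ i, ⟪b i, Z (b i)⟫_ℂ = 0 := by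
  obtain ⟨s, ⟨hs, hs0⟩, hmax⟩ := zorn_subset
    {s : Set H | Orthonormal ℂ (Subtype.val : s → H) ∧ ∀ v ∈ s, ⟪v, Z v⟫_ℂ = 0} fun c hc hchain =>
      ⟨⋃₀ c, ⟨orthonormal_sUnion_of_directed hchain.directedOn fun x hx => (hc hx).1,
        fun v ⟨t, ht, hv⟩ => (hc ht).2 v hv⟩, fun _ => Set.subset_sUnion_of_mem⟩
  obtain ⟨u, b, hsu, hb⟩ := hs.exists_hilbertBasis_extension (𝕜 := ℂ)
  have hu : Orthonormal ℂ (Subtype.val : u → H) := hb ▸ b.orthonormal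
  have hsum := hZ u b
  rw [hb] at hsum
  refine ⟨u, b, fun i => ?_⟩
  rw [hb]
  by_contra hi
  have hius : (i : H) ∈ u \ s := ⟨i.2, fun h => hi (hs0 _ h)⟩
  have : Nonempty ↥(u \ s) := ⟨⟨_, hius⟩⟩
  set W : Submodule ℂ H := (Submodule.span ℂ s)ᗮ with hW
  -- The terms dropped from the full diagonal are those indexed by `s`, which vanish.
  have hsum' : HasSum (fun j : ↥(u \ s) => ⟪(j : H), Z j⟫_ℂ) 0 := by
    let e : ↥(u \ s) → u := fun j => ⟨j, j.2.1⟩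
    have he : Function.Injective e := fun j k h => Subtype.ext (congrArg (fun x : u => (x : H)) h)
    refine (he.hasSum_iff (f := fun j : u => ⟪(j : H), Z j⟫_ℂ) fun j hj => hs0 _ ?_).mpr hsum
    by_contra hjs
    exact hj ⟨⟨j, j.2, hjs⟩, rfl⟩
  obtain ⟨w, hwW, hw1, hw0⟩ := zero_mem_of_hasSum_zero _ ℂ rfl _ (convex_numericalRange Z W)
    (fun j : ↥(u \ s) => ⟪(j : H), Z j⟫_ℂ) (fun j => ⟨j, by
      rw [hW, Submodule.mem_orthogonal]
      intro x hx
      induction hx using Submodule.span_induction with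
      | mem x hx =>
        exact hu.2 (i := ⟨x, hsu hx⟩) (j := ⟨j, j.2.1⟩)
          fun h => j.2.2 ((congrArg Subtype.val h) ▸ hx)
      | zero => exact inner_zero_left _
      | add x y _ _ hx hy => rw [inner_add_left, hx, hy, add_zero]
      | smul c x _ hx => rw [inner_smul_left, hx, mul_zero], hu.1 ⟨j, j.2.1⟩, rfl⟩) hsum'
  have hws : w ∉ s := fun h => by
    have := (Submodule.mem_orthogonal _ _).mp hwW w (Submodule.subset_span h)
    rw [inner_self_eq_zero] at this
    simp [this] at hw1
  -- The unit vector `w` is orthogonal to `s` and has zero form, so `insert w s` contradicts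
  -- maximality.
  refine hws (hmax (y := insert w s) ⟨?_, ?_⟩ (Set.subset_insert _ _) (Set.mem_insert _ _))
  · classical
    rw [orthonormal_subtype_iff_ite] at hs ⊢
    have hort : ∀ x ∈ s, ⟪x, w⟫_ℂ = 0 := fun x hx =>
      (Submodule.mem_orthogonal _ _).mp hwW x (Submodule.subset_span hx)
    rintro x (rfl | hx) y (rfl | hy)
    · rw [if_pos rfl, inner_self_eq_norm_sq_to_K, hw1]; simp
    · rw [if_neg (fun h : x = y => hws (h ▸ hy)), inner_eq_zero_symm, hort y hy]
    · rw [if_neg (fun h : x = y => hws (h ▸ hx)), hort x hx]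
    · exact hs x hx y hy
  · rintro v (rfl | hv)
    · exact hw0
    · exact hs0 v hv

end ZeroDiagonal

/-! ### Complex conjugation relative to a basis. -/

section Conjugation

variable {ι : Type*} {B : Type v} [NormedAddCommGroup B] [InnerProductSpace ℂ B]

/-- The complex conjugation of `B` in which the basis vectors of `f` are real. -/
def conjugate (f : HilbertBasis ι ℂ B) (x : B) : B := f.repr.symm (star (f.repr x))

theorem inner_basis_conjugate (f : HilbertBasis ι ℂ B) (i : ι) (x : B) :
    ⟪f i, conjugate f x⟫_ℂ = ⟪x, f i⟫_ℂ := by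
  rw [← f.repr_apply_apply, conjugate, LinearIsometryEquiv.apply_symm_apply, lp.star_apply,
    f.repr_apply_apply, ← inner_conj_symm, Complex.star_def, RingHomCompTriple.comp_apply,
    RingHom.id_apply]

theorem conjugate_conjugate (f : HilbertBasis ι ℂ B) (x : B) :
    conjugate f (conjugate f x) = x := by
  simp [conjugate]

theorem inner_conjugate_conjugate (f : HilbertBasis ι ℂ B) (x y : B) :
    ⟪conjugate f x, conjugate f y⟫_ℂ = ⟪y, x⟫_ℂ := by
  refine (f.hasSum_inner_mul_inner _ _).unique ?_
  convert f.hasSum_inner_mul_inner y x using 2 with i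
  rw [inner_basis_conjugate, ← inner_conj_symm, inner_basis_conjugate, inner_conj_symm, mul_comm]

/-- The complex conjugate of a Hilbert basis. -/
theorem exists_hilbertBasis_conjugate [CompleteSpace B] (f : HilbertBasis ι ℂ B) {κ : Type*}
    (b : HilbertBasis κ ℂ B) :
    ∃ b' : HilbertBasis κ ℂ B, ∀ i, b' i = conjugate f (b i) := by
  classical
  have hv : Orthonormal ℂ fun i => conjugate f (b i) := by
    rw [orthonormal_iff_ite]
    intro i j
    rw [inner_conjugate_conjugate, orthonormal_iff_ite.mp b.orthonormal]
    simp only [eq_comm]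
  refine ⟨HilbertBasis.mkOfOrthogonalEqBot hv ?_, fun i => by
    rw [HilbertBasis.coe_mkOfOrthogonalEqBot]⟩
  rw [eq_bot_iff]
  intro x hx
  have h0 : ∀ i, ⟪conjugate f x, b i⟫_ℂ = 0 := fun i => by
    have := (Submodule.mem_orthogonal _ _).mp hx _ (Submodule.subset_span ⟨i, rfl⟩)
    rw [← this]
    conv_rhs => rw [← conjugate_conjugate f x]
    rw [inner_conjugate_conjugate]
  have h1 : ⟪conjugate f x, conjugate f x⟫_ℂ = 0 :=
    (b.hasSum_inner_mul_inner _ _).unique (by simp [h0])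
  rw [inner_conjugate_conjugate, inner_self_eq_zero] at h1
  exact h1

end Conjugation

/-! ### Slicing the tensor product along a basis of `B`. -/

section Tensor

variable {A : Type u} {B : Type v}
  [NormedAddCommGroup A] [InnerProductSpace ℂ A]
  [NormedAddCommGroup B] [InnerProductSpace ℂ B]

theorem inner_tensorRight_tensorRight (a a' : A) (b b' : B) :
    ⟪tensorRight A b a, tensorRight A b' a'⟫_ℂ = ⟪a, a'⟫_ℂ * ⟪b, b'⟫_ℂ := by
  rw [tensorRight_apply, tensorRight_apply, UniformSpace.Completion.inner_coe,
    TensorProduct.inner_tmul]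

theorem norm_tensorRight (a : A) (b : B) : ‖tensorRight A b a‖ = ‖a‖ * ‖b‖ := by
  rw [tensorRight_apply, UniformSpace.Completion.norm_coe, TensorProduct.norm_tmul]

theorem onLeft_tensorRight {A' : Type u} [NormedAddCommGroup A'] [InnerProductSpace ℂ A']
    (K : A →L[ℂ] A') (a : A) (b : B) :
    onLeft K (tensorRight A b a) = tensorRight A' b (K a) := by
  rw [tensorRight_apply, tensorRight_apply, onLeft, ContinuousLinearMap.completion_apply_coe,
    TensorProduct.mapL_tmul]
  rfl

theorem onRight_tensorRight {B' : Type v} [NormedAddCommGroup B'] [InnerProductSpace ℂ B']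
    (K : B →L[ℂ] B') (a : A) (b : B) :
    onRight K (tensorRight A b a) = tensorRight A (K b) a := by
  rw [tensorRight_apply, tensorRight_apply, onRight, ContinuousLinearMap.completion_apply_coe,
    TensorProduct.mapL_tmul]
  rfl

theorem tensorRight_smul (c : ℂ) (b : B) (a : A) :
    tensorRight A (c • b) a = c • tensorRight A b a := by
  simp [tensorRight_apply]

/-- `b ↦ a ⊗ b` as a bounded operator. -/
def tensorLeft (B : Type v) [NormedAddCommGroup B] [InnerProductSpace ℂ B] (a : A) :
    B →L[ℂ] HilbertTensor A B :=
  UniformSpace.Completion.toComplL ∘L (TensorProduct.mkL ℂ A B) a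

theorem tensorLeft_apply (a : A) (b : B) : tensorLeft B a b = tensorRight A b a := rfl

theorem ext_inner_tensorRight {ψ φ : HilbertTensor A B}
    (h : ∀ a b, ⟪tensorRight A b a, ψ⟫_ℂ = ⟪tensorRight A b a, φ⟫_ℂ) : ψ = φ := by
  refine ext_inner_left ℂ fun χ => ?_
  induction χ using UniformSpace.Completion.induction_on with
  | hp => exact isClosed_eq (by fun_prop) (by fun_prop)
  | ih χ =>
    induction χ using TensorProduct.induction_on with
    | zero => rw [UniformSpace.Completion.coe_zero, inner_zero_left, inner_zero_left]
    | tmul a b => exact h a b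
    | add x y hx hy =>
      rw [UniformSpace.Completion.coe_add, inner_add_left, inner_add_left, hx, hy]

theorem ext_inner_basis {κ : Type*} (b : HilbertBasis κ ℂ B) {ψ φ : HilbertTensor A B}
    (h : ∀ a i, ⟪tensorRight A (b i) a, ψ⟫_ℂ = ⟪tensorRight A (b i) a, φ⟫_ℂ) : ψ = φ := by
  refine ext_inner_tensorRight fun a y => ?_
  have hcl : IsClosed {y : B | ⟪tensorLeft B a y, ψ⟫_ℂ = ⟪tensorLeft B a y, φ⟫_ℂ} :=
    isClosed_eq (by fun_prop) (by fun_prop)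
  have hy : y ∈ closure (Submodule.span ℂ (Set.range b) : Set B) := by
    rw [← Submodule.topologicalClosure_coe, b.dense_span]
    trivial
  refine hcl.closure_subset_iff.mpr (fun x hx => ?_) hy
  rw [Set.mem_ofPred_eq]
  induction hx using Submodule.span_induction with
  | mem x hx => obtain ⟨i, rfl⟩ := hx; exact h a i
  | zero => simp
  | add x y _ _ hx hy => rw [map_add, inner_add_left, inner_add_left, hx, hy]
  | smul c x _ hx => rw [map_smul, inner_smul_left, inner_smul_left, hx]

variable [CompleteSpace A]

/-- `tensorRight` for a unit vector as an isometry. -/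
def tensorRightIsometry (A : Type u) [NormedAddCommGroup A] [InnerProductSpace ℂ A] (b : B)
    (hb : ‖b‖ = 1) : A →ₗᵢ[ℂ] HilbertTensor A B where
  toLinearMap := (tensorRight A b).toLinearMap
  norm_map' a := by
    change ‖tensorRight A b a‖ = ‖a‖
    rw [norm_tensorRight, hb, mul_one]

theorem isHilbertSum_tensorRight {κ : Type*} (b : HilbertBasis κ ℂ B) :
    IsHilbertSum ℂ (fun _ : κ => A) fun i => tensorRightIsometry A (b i) (b.orthonormal.1 i) := by
  refine IsHilbertSum.mk ?_ ?_
  · intro i j hij a a'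
    change ⟪tensorRight A (b i) a, tensorRight A (b j) a'⟫_ℂ = 0
    rw [inner_tensorRight_tensorRight, b.orthonormal.2 hij, mul_zero]
  · rw [← Submodule.orthogonal_orthogonal_eq_closure, ← eq_top_iff,
      Submodule.orthogonal_eq_top_iff, eq_bot_iff]
    intro ψ hψ
    refine ext_inner_basis b fun a i => ?_
    rw [inner_zero_right]
    exact (Submodule.mem_orthogonal _ _).mp hψ _
      (Submodule.mem_iSup_of_mem i ⟨a, rfl⟩)

/-- Parseval for the decomposition of `A ⊗ B` into the orthogonal summands `A ⊗ b i`. -/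
theorem hasSum_inner_coeff {κ : Type*} (b : HilbertBasis κ ℂ B) (ψ φ : HilbertTensor A B) :
    HasSum (fun i => ⟪coeff (b i) ψ, coeff (b i) φ⟫_ℂ) ⟪ψ, φ⟫_ℂ := by
  classical
  set U := (isHilbertSum_tensorRight (A := A) b).linearIsometryEquiv
  have hc : ∀ χ i, U χ i = coeff (b i) χ := fun χ i => by
    refine ext_inner_left ℂ fun a => ?_
    have h1 : ⟪a, U χ i⟫_ℂ = ⟪lp.single 2 i a, U χ⟫_ℂ :=
      (lp.inner_single_left (𝕜 := ℂ) (G := fun _ : κ => A) i a (U χ)).symm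
    have h2 : U.symm (lp.single 2 i a) = tensorRight A (b i) a :=
      (isHilbertSum_tensorRight (A := A) b).linearIsometryEquiv_symm_apply_single a
    rw [← inner_tensorRight, ← h2, ← U.inner_map_map, U.apply_symm_apply]
    exact h1
  have := lp.hasSum_inner (𝕜 := ℂ) (U ψ) (U φ)
  simp only [hc] at this
  rwa [U.inner_map_map] at this

theorem hasSum_norm_coeff_sq {κ : Type*} (b : HilbertBasis κ ℂ B) (ψ : HilbertTensor A B) :
    HasSum (fun i => ‖coeff (b i) ψ‖ ^ 2) (‖ψ‖ ^ 2) := by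
  have h := Complex.reCLM.hasSum (hasSum_inner_coeff b ψ ψ)
  convert h using 1
  · ext i
    exact (inner_self_eq_norm_sq (𝕜 := ℂ) (coeff (b i) ψ)).symm
  · exact (inner_self_eq_norm_sq (𝕜 := ℂ) ψ).symm

/-- The rank one operator `|b⟩⟨b|`. -/
def rankOne {H : Type*} [NormedAddCommGroup H] [InnerProductSpace ℂ H] (b : H) : H →L[ℂ] H :=
  (innerSL ℂ b).smulRight b

theorem rankOne_apply {H : Type*} [NormedAddCommGroup H] [InnerProductSpace ℂ H] (b x : H) :
    rankOne b x = ⟪b, x⟫_ℂ • b := rfl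

/-- After Bob's rank one outcome the state is a product vector, so only Alice's factor still carries
information. -/
theorem onRight_rankOne (b : B) (ψ : HilbertTensor A B) :
    onRight (rankOne b) ψ = tensorRight A b (coeff b ψ) := by
  induction ψ using UniformSpace.Completion.induction_on with
  | hp =>
    refine isClosed_eq (onRight (rankOne b)).continuous ?_
    exact (tensorRight A b ∘L ContinuousLinearMap.adjoint (tensorRight A b)).continuous
  | ih χ =>
    induction χ using TensorProduct.induction_on with
    | zero => rw [UniformSpace.Completion.coe_zero, coeff, map_zero, map_zero, map_zero]
    | tmul a y =>
      change onRight (rankOne b) (tensorRight A y a) = tensorRight A b (coeff b (tensorRight A y a))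
      have hc : coeff b (tensorRight A y a) = ⟪b, y⟫_ℂ • a := by
        refine ext_inner_left ℂ fun a' => ?_
        rw [← inner_tensorRight, inner_tensorRight_tensorRight, inner_smul_right, mul_comm]
      rw [onRight_tensorRight, rankOne_apply, hc, map_smul, tensorRight_smul]
    | add x y hx hy =>
      rw [UniformSpace.Completion.coe_add, map_add, hx, hy, coeff, coeff, coeff, map_add, map_add]

/-- The conjugation appears because `coeff` is antilinear in its `B` argument while `operatorOf` is
linear. -/
theorem operatorOf_apply {ι : Type*} (f : HilbertBasis ι ℂ B) (ψ : HilbertTensor A B) (x : B) :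
    operatorOf f ψ x = coeff (conjugate f x) ψ := by
  refine (summable_smul_coeff f ψ x).hasSum.unique ?_
  have h1 : HasSum (fun i => ⟪f i, conjugate f x⟫_ℂ • f i) (conjugate f x) := by
    simpa only [f.repr_apply_apply] using f.hasSum_repr (conjugate f x)
  have h2 : ∀ a : A, HasSum (fun i => ⟪a, ⟪f i, x⟫_ℂ • coeff (f i) ψ⟫_ℂ)
      ⟪a, coeff (conjugate f x) ψ⟫_ℂ := fun a => by
    -- The inner product is antilinear on the left, so the series passes through the right slot and
    -- is then conjugated.
    have h3 := ((h1.mapL (tensorLeft B a)).mapL (innerSL ℂ ψ)).mapL (Complex.conjCLE : ℂ →L[ℝ] ℂ)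
    convert h3 using 1
    · ext i
      simp [tensorLeft_apply, inner_basis_conjugate, inner_tensorRight]
    · simp [tensorLeft_apply, inner_tensorRight]
  obtain ⟨y, hy⟩ := summable_smul_coeff f ψ x
  have : coeff (conjugate f x) ψ = y := ext_inner_left ℂ fun a =>
    (h2 a).unique (hy.mapL (innerSL ℂ a))
  rwa [this]

end Tensor

/-! ### Rank one measurements and adapted bases. -/

section Measurements

variable {H : Type*} [NormedAddCommGroup H] [InnerProductSpace ℂ H]

theorem isMeasurement_rankOne {κ : Type*} {ι : Type} (b : HilbertBasis κ ℂ H) (e : ι ≃ κ) :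
    IsMeasurement fun i => rankOne (b (e i)) := fun x y => by
  have h : ∀ j, ⟪rankOne (b j) x, rankOne (b j) y⟫_ℂ = ⟪x, b j⟫_ℂ * ⟪b j, y⟫_ℂ := fun j => by
    rw [rankOne_apply, rankOne_apply, inner_smul_left, inner_smul_right,
      inner_self_eq_norm_sq_to_K, b.orthonormal.1, inner_conj_symm]
    simp
  simp_rw [h]
  exact e.hasSum_iff.mpr (b.hasSum_inner_mul_inner x y)

/-- Distinct members are at distance `√2`, so the balls of radius `1/2` are disjoint. -/
theorem countable_of_orthonormal [TopologicalSpace.SeparableSpace H] {κ : Type*} {v : κ → H}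
    (hv : Orthonormal ℂ v) : Countable κ := by
  refine Pairwise.countable_of_isOpen_disjoint (s := fun i => Metric.ball (v i) (1 / 2)) ?_
    (fun _ => Metric.isOpen_ball) fun i => ⟨v i, Metric.mem_ball_self (by norm_num)⟩
  intro i j hij
  refine Metric.ball_disjoint_ball ?_
  have h : ‖v i - v j‖ ^ 2 = 2 := by
    rw [@norm_sub_sq ℂ, hv.2 hij, hv.1, hv.1]
    norm_num
  rw [dist_eq_norm]
  nlinarith [norm_nonneg (v i - v j)]

/-- Pairwise orthogonal vectors have an orthonormal basis each of whose members is non-orthogonal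
to at most one of them. -/
theorem exists_hilbertBasis_unique_inner_ne_zero [CompleteSpace H] {κ : Type*} (a : κ → H)
    (ha : ∀ m l, m ≠ l → ⟪a m, a l⟫_ℂ = 0) :
    ∃ (s : Set H) (b : HilbertBasis s ℂ H),
      ∀ i m l, ⟪b i, a m⟫_ℂ ≠ 0 → ⟪b i, a l⟫_ℂ ≠ 0 → m = l := by
  have hv : Orthonormal ℂ fun l : {l // a l ≠ 0} => ((‖a l‖⁻¹ : ℝ) : ℂ) • a l := by
    refine ⟨fun l => ?_, fun m l hml => ?_⟩
    · rw [norm_smul, Complex.norm_real, norm_inv, norm_norm,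
        inv_mul_cancel₀ (norm_ne_zero_iff.mpr l.2)]
    · change ⟪((‖a m‖⁻¹ : ℝ) : ℂ) • a m, ((‖a l‖⁻¹ : ℝ) : ℂ) • a l⟫_ℂ = 0
      rw [inner_smul_left, inner_smul_right, ha m l fun h => hml (Subtype.ext h), mul_zero,
        mul_zero]
  obtain ⟨s, b, hs, hb⟩ := hv.toSubtypeRange.exists_hilbertBasis_extension
  -- The basis extends the normalized nonzero `a l`, so each of its members is either a normalized
  -- `a m` or orthogonal to all of them.
  have key : ∀ i m, ⟪b i, a m⟫_ℂ ≠ 0 → b i = ((‖a m‖⁻¹ : ℝ) : ℂ) • a m := fun i m hm => by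
    have ham : a m ≠ 0 := fun h => hm (by rw [h, inner_zero_right])
    let j : s := ⟨_, hs ⟨⟨m, ham⟩, rfl⟩⟩
    have hj : b j = ((‖a m‖⁻¹ : ℝ) : ℂ) • a m := by rw [hb]
    by_contra hne
    have hij : i ≠ j := fun h => hne (h ▸ hj)
    have h0 : ⟪b i, b j⟫_ℂ = 0 := b.orthonormal.2 hij
    rw [hj, inner_smul_right, mul_eq_zero] at h0
    exact h0.elim (fun h => ham (by simpa using h)) hm
  refine ⟨s, b, fun i m l hm hl => ?_⟩
  by_contra hml
  apply hl
  rw [key i m hm, inner_smul_left, ha m l hml, mul_zero]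

end Measurements

/-! ### The protocol and the choice of the operator. -/

section Discrimination

variable {A : Type u} {B : Type v}
  [NormedAddCommGroup A] [InnerProductSpace ℂ A] [CompleteSpace A]
  [TopologicalSpace.SeparableSpace A]
  [NormedAddCommGroup B] [InnerProductSpace ℂ B] [CompleteSpace B]

/-- Alice can distinguish product vectors whose components on her side are pairwise orthogonal. -/
theorem exists_alice_protocol {M : ℕ} [Nonempty (Fin M)] (w : B) (hw : ‖w‖ = 1) (a : Fin M → A)
    (ha : ∀ m l, m ≠ l → ⟪a m, a l⟫_ℂ = 0) :
    ∃ P : LOCC M 1 A B, ∀ l m, P.prob (tensorRight A w (a l)) m =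
      if m = l then ENNReal.ofReal (‖a l‖ ^ 2) else 0 := by
  classical
  obtain ⟨s, b, hb⟩ := exists_hilbertBasis_unique_inner_ne_zero a ha
  have hs : Countable s := countable_of_orthonormal b.orthonormal
  -- Outcome labels must live in `Type`; countability allows the index set to be shrunk there.
  have : Small.{0} s := Countable.toSmall s
  let e : Shrink.{0} s ≃ s := (equivShrink.{0} s).symm
  -- An outcome compatible with no `l` has probability zero on every state, so its guess is
  -- arbitrary.
  have hg : ∀ i : Shrink.{0} s, ∃ g : Fin M, ∀ l, ⟪b (e i), a l⟫_ℂ ≠ 0 → g = l := fun i => by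
    by_cases h : ∃ g, ⟪b (e i), a g⟫_ℂ ≠ 0
    · obtain ⟨g, hg⟩ := h
      exact ⟨g, fun l hl => hb _ _ _ hg hl⟩
    · push Not at h
      exact ⟨Classical.arbitrary _, fun l hl => absurd (h l) hl⟩
  choose g hg using hg
  refine ⟨LOCC.alice (e.countable_iff.mpr hs) (fun i => rankOne (b (e i)))
    (isMeasurement_rankOne b e) fun i => LOCC.guess (g i), fun l m => ?_⟩
  have hprob : ∀ i, LOCC.prob (LOCC.guess (r := 0) (g i) : LOCC M 0 A B)
      (onLeft (rankOne (b (e i))) (tensorRight A w (a l))) m =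
      if m = l then ENNReal.ofReal (‖⟪b (e i), a l⟫_ℂ‖ ^ 2) else 0 := fun i => by
    rw [LOCC.prob, onLeft_tensorRight, norm_tensorRight, hw, mul_one, rankOne_apply, norm_smul,
      b.orthonormal.1, mul_one]
    by_cases h : ⟪b (e i), a l⟫_ℂ = 0
    · simp [h]
    · rw [hg i l h]
  rw [LOCC.prob]
  simp_rw [hprob]
  split_ifs with h
  · have hsum : HasSum (fun i => ‖⟪b (e i), a l⟫_ℂ‖ ^ 2) (‖a l‖ ^ 2) := by
      refine e.hasSum_iff (f := fun i => ‖⟪b i, a l⟫_ℂ‖ ^ 2) |>.mpr ?_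
      have h1 := Complex.reCLM.hasSum (b.hasSum_inner_mul_inner (a l) (a l))
      convert h1 using 1
      · ext i
        rw [Complex.reCLM_apply, ← inner_conj_symm (a l) (b i), Complex.conj_mul', ← Complex.ofReal_pow, Complex.ofReal_re]
      · exact (inner_self_eq_norm_sq (𝕜 := ℂ) (a l)).symm
    rw [← ENNReal.ofReal_tsum_of_nonneg (fun _ => by positivity) hsum.summable, hsum.tsum_eq]
  · exact tsum_zero

variable [TopologicalSpace.SeparableSpace B]

/-- If Bob can measure in an orthonormal basis all of whose outcomes leave Alice with pairwise
orthogonal vectors, then the states are distinguishable by LOCC. -/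
theorem distinguishableByLOCC_of_hilbertBasis {M : ℕ} [Nonempty (Fin M)]
    (ψ : Fin M → HilbertTensor A B) (hψ : ∀ l, ‖ψ l‖ = 1) {κ : Type*} (b : HilbertBasis κ ℂ B)
    (hb : ∀ i m l, m ≠ l → ⟪coeff (b i) (ψ m), coeff (b i) (ψ l)⟫_ℂ = 0) :
    DistinguishableByLOCC ψ := by
  have hκ : Countable κ := countable_of_orthonormal b.orthonormal
  have : Small.{0} κ := Countable.toSmall κ
  let e : Shrink.{0} κ ≃ κ := (equivShrink.{0} κ).symm
  choose P hP using fun i => exists_alice_protocol (b (e i)) (b.orthonormal.1 _)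
    (fun l => coeff (b (e i)) (ψ l)) (hb (e i))
  refine ⟨2, LOCC.bob (e.countable_iff.mpr hκ) (fun i => rankOne (b (e i)))
    (isMeasurement_rankOne b e) P, fun l m => ?_⟩
  rw [LOCC.prob]
  simp_rw [onRight_rankOne, hP]
  split_ifs with h
  · have hsum : HasSum (fun i => ‖coeff (b (e i)) (ψ l)‖ ^ 2) 1 := by
      have h0 := hasSum_norm_coeff_sq b (ψ l)
      rw [hψ, one_pow] at h0
      exact e.hasSum_iff.mpr h0
    have h1 := ENNReal.ofReal_tsum_of_nonneg (fun _ => sq_nonneg _) hsum.summable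
    rw [hsum.tsum_eq, ENNReal.ofReal_one] at h1
    exact h1.symm
  · exact tsum_zero

omit [TopologicalSpace.SeparableSpace A] [TopologicalSpace.SeparableSpace B] in
-- This is `tr (X† Y) = ⟪ψ, φ⟫` in every basis, read off from Parseval in the conjugate basis; no
-- theory of trace-class operators is needed.
theorem hasSum_inner_operatorOf {ι κ : Type*} (f : HilbertBasis ι ℂ B) (b : HilbertBasis κ ℂ B)
    (ψ φ : HilbertTensor A B) :
    HasSum (fun i => ⟪operatorOf f ψ (b i), operatorOf f φ (b i)⟫_ℂ) ⟪ψ, φ⟫_ℂ := by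
  obtain ⟨b', hb'⟩ := exists_hilbertBasis_conjugate f b
  simpa only [operatorOf_apply, ← hb'] using hasSum_inner_coeff b' ψ φ

/-- Orthonormal vectors are distinguishable by LOCC if the vanishing of the diagonal of one
operator with trace zero forces the vanishing of the diagonals of all `(X m)† (X l)`, `m ≠ l`. -/
theorem distinguishableByLOCC_of_operator {M : ℕ} [Nonempty (Fin M)] {ι : Type*}
    (f : HilbertBasis ι ℂ B) (ψ : Fin M → HilbertTensor A B) (hψ : Orthonormal ℂ ψ) (Z : B →L[ℂ] B)
    (hZ : ∀ (s : Set B) (b : HilbertBasis s ℂ B), HasSum (fun i => ⟪b i, Z (b i)⟫_ℂ) 0)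
    (hZ0 : ∀ v, ⟪v, Z v⟫_ℂ = 0 → ∀ m l, m ≠ l →
      ⟪operatorOf f (ψ m) v, operatorOf f (ψ l) v⟫_ℂ = 0) :
    DistinguishableByLOCC ψ := by
  obtain ⟨s, b, hb⟩ := exists_hilbertBasis_zero_diagonal Z hZ
  obtain ⟨b', hb'⟩ := exists_hilbertBasis_conjugate f b
  refine distinguishableByLOCC_of_hilbertBasis ψ hψ.1 b' fun i m l hml => ?_
  simpa only [operatorOf_apply, ← hb'] using hZ0 _ (hb i) m l hml

omit [TopologicalSpace.SeparableSpace A] [TopologicalSpace.SeparableSpace B] in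
theorem inner_adjoint_comp (X Y : B →L[ℂ] A) (v : B) :
    ⟪v, (ContinuousLinearMap.adjoint X ∘L Y) v⟫_ℂ = ⟪X v, Y v⟫_ℂ := by
  rw [ContinuousLinearMap.comp_apply, ContinuousLinearMap.adjoint_inner_right]

omit [TopologicalSpace.SeparableSpace A] [TopologicalSpace.SeparableSpace B] in
theorem hasSum_diagonal_of_mem_associatedSpace {ι κ : Type*} (f : HilbertBasis ι ℂ B) {M : ℕ}
    {ψ : Fin M → HilbertTensor A B} (hψ : Orthonormal ℂ ψ) (b : HilbertBasis κ ℂ B)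
    {S : B →L[ℂ] B} (hS : S ∈ associatedSpace f ψ) :
    HasSum (fun i => ⟪b i, S (b i)⟫_ℂ) 0 := by
  have hml : ∀ m l, m ≠ l → HasSum (fun i => ⟪b i, (ContinuousLinearMap.adjoint
      (operatorOf f (ψ m)) ∘L operatorOf f (ψ l)) (b i)⟫_ℂ) 0 := fun m l hml => by
    simp_rw [inner_adjoint_comp]
    simpa only [hψ.2 hml] using hasSum_inner_operatorOf f b (ψ m) (ψ l)
  induction hS using Submodule.span_induction with
  | mem S hS =>
    obtain ⟨m, l, hne, rfl | rfl⟩ := hS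
    · simpa [inner_add_right] using (hml m l hne).add (hml l m hne.symm)
    · simpa [inner_sub_right, inner_smul_right] using
        ((hml m l hne).sub (hml l m hne.symm)).mul_left Complex.I
  | zero => simp
  | add S T _ _ hS hT => simpa [inner_add_right] using hS.add hT
  | smul c S _ hS =>
    have h := hS.mul_left (c : ℂ)
    rw [mul_zero] at h
    simp_rw [smul_apply, ← Complex.coe_smul, inner_smul_right]
    exact h

omit [TopologicalSpace.SeparableSpace A] [TopologicalSpace.SeparableSpace B] in
theorem im_inner_of_mem_associatedSpace {ι : Type*} (f : HilbertBasis ι ℂ B) {M : ℕ}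
    {ψ : Fin M → HilbertTensor A B} {S : B →L[ℂ] B} (hS : S ∈ associatedSpace f ψ) (v : B) :
    (⟪v, S v⟫_ℂ).im = 0 := by
  induction hS using Submodule.span_induction with
  | mem S hS =>
    obtain ⟨m, l, hne, rfl | rfl⟩ := hS
    · rw [add_apply, inner_add_right, inner_adjoint_comp, inner_adjoint_comp,
        ← inner_conj_symm, Complex.add_im, Complex.conj_im]
      ring
    · rw [smul_apply, sub_apply, inner_smul_right,
        inner_sub_right, inner_adjoint_comp, inner_adjoint_comp,
        ← inner_conj_symm, Complex.I_mul_im, Complex.sub_re, Complex.conj_re]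
      ring
  | zero => simp
  | add S T _ _ hS hT =>
    rw [add_apply, inner_add_right, Complex.add_im, hS, hT, add_zero]
  | smul c S _ hS =>
    rw [smul_apply, ← Complex.coe_smul, inner_smul_right, Complex.im_ofReal_mul, hS, mul_zero]

omit [TopologicalSpace.SeparableSpace A] [TopologicalSpace.SeparableSpace B] in
-- The two generators for `m`, `l` yield the sum and, up to the factor `i`, the difference of `⟪X_m
-- v, X_l v⟫` and its conjugate.
theorem inner_operatorOf_eq_zero {ι : Type*} (f : HilbertBasis ι ℂ B) {M : ℕ}
    {ψ : Fin M → HilbertTensor A B} {v : B}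
    (h : ∀ S ∈ associatedSpace f ψ, ⟪v, S v⟫_ℂ = 0) {m l : Fin M} (hml : m ≠ l) :
    ⟪operatorOf f (ψ m) v, operatorOf f (ψ l) v⟫_ℂ = 0 := by
  have h1 := h _ (Submodule.subset_span ⟨m, l, hml, Or.inl rfl⟩)
  have h2 := h _ (Submodule.subset_span ⟨m, l, hml, Or.inr rfl⟩)
  rw [add_apply, inner_add_right, inner_adjoint_comp, inner_adjoint_comp] at h1
  rw [smul_apply, sub_apply, inner_smul_right,
    inner_sub_right, inner_adjoint_comp, inner_adjoint_comp, mul_eq_zero,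
    or_iff_right Complex.I_ne_zero] at h2
  linear_combination (h1 + h2) / 2

theorem distinguishableByLOCC_of_finrank_eq_two {ι : Type*} (f : HilbertBasis ι ℂ B) {M : ℕ}
    (ψ : Fin M → HilbertTensor A B) (hψ : Orthonormal ℂ ψ)
    (hdim : Module.finrank ℝ (associatedSpace f ψ) = 2) : DistinguishableByLOCC ψ := by
  -- A protocol needs some label to guess; for `M = 0` the associated space would be zero.
  have hM : Nonempty (Fin M) := by
    by_contra hM
    rw [not_nonempty_iff] at hM
    have hbot : associatedSpace f ψ = ⊥ := by
      rw [associatedSpace, Submodule.span_eq_bot]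
      rintro S ⟨m, -⟩
      exact hM.elim m
    rw [hbot, finrank_bot] at hdim
    omega
  have : Module.Finite ℝ (associatedSpace f ψ) := Module.finite_of_finrank_pos (by omega)
  let c := Module.finBasisOfFinrankEq ℝ (associatedSpace f ψ) hdim
  set S : B →L[ℂ] B := (c 0).1
  set T : B →L[ℂ] B := (c 1).1
  have hS : S ∈ associatedSpace f ψ := (c 0).2
  have hT : T ∈ associatedSpace f ψ := (c 1).2
  -- The forms of `S` and `T` are the real and imaginary parts of the form of `S + iT`, so they
  -- vanish together with it.
  refine distinguishableByLOCC_of_operator f ψ hψ (S + Complex.I • T) (fun s b => ?_)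
    fun v hv m l hml => inner_operatorOf_eq_zero f (fun G hG => ?_) hml
  · simpa [inner_add_right, inner_smul_right] using
      (hasSum_diagonal_of_mem_associatedSpace f hψ b hS).add
        ((hasSum_diagonal_of_mem_associatedSpace f hψ b hT).mul_left Complex.I)
  · rw [add_apply, smul_apply, inner_add_right,
      inner_smul_right] at hv
    have hSi := im_inner_of_mem_associatedSpace f hS v
    have hTi := im_inner_of_mem_associatedSpace f hT v
    have hre := congrArg Complex.re hv
    have him := congrArg Complex.im hv
    simp only [Complex.add_re, Complex.add_im, Complex.I_mul_re, Complex.I_mul_im, hSi, hTi,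
      Complex.zero_re, Complex.zero_im, neg_zero, add_zero, zero_add] at hre him
    have hS0 : ⟪v, S v⟫_ℂ = 0 := Complex.ext hre hSi
    have hT0 : ⟪v, T v⟫_ℂ = 0 := Complex.ext him hTi
    have hGc := congrArg Subtype.val (c.sum_repr ⟨G, hG⟩)
    rw [Fin.sum_univ_two] at hGc
    change c.repr ⟨G, hG⟩ 0 • S + c.repr ⟨G, hG⟩ 1 • T = G at hGc
    rw [← hGc, add_apply, smul_apply,
      smul_apply, inner_add_right, ← Complex.coe_smul, ← Complex.coe_smul,
      inner_smul_right, inner_smul_right, hS0, hT0, mul_zero, mul_zero, add_zero]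

theorem distinguishableByLOCC_two (ψ : Fin 2 → HilbertTensor A B) (hψ : Orthonormal ℂ ψ) :
    DistinguishableByLOCC ψ := by
  obtain ⟨s, f, -⟩ := exists_hilbertBasis ℂ B
  -- The pair `(1, 0)` gives the conjugate of the form for `(0, 1)`, so this single operator
  -- suffices whatever the dimension of the associated space.
  refine distinguishableByLOCC_of_operator f ψ hψ
    (ContinuousLinearMap.adjoint (operatorOf f (ψ 0)) ∘L operatorOf f (ψ 1)) (fun s b => ?_)
    fun v hv m l hml => ?_
  · simp_rw [inner_adjoint_comp]
    simpa only [hψ.2 (zero_ne_one (α := Fin 2))] using hasSum_inner_operatorOf f b (ψ 0) (ψ 1)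
  · rw [inner_adjoint_comp] at hv
    fin_cases m <;> fin_cases l
    · exact absurd rfl hml
    · exact hv
    · exact inner_eq_zero_symm.mp hv
    · exact absurd rfl hml

end Discrimination

end LocalDiscrimination

end

theorem theorem2p1
    {A : Type*} {B : Type*}
    [NormedAddCommGroup A] [InnerProductSpace ℂ A] [CompleteSpace A]
    [TopologicalSpace.SeparableSpace A]
    [NormedAddCommGroup B] [InnerProductSpace ℂ B] [CompleteSpace B]
    [TopologicalSpace.SeparableSpace B] :
    (∀ {ι : Type*} (f : HilbertBasis ι ℂ B) (M : ℕ)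
        (ψ : Fin M → LocalDiscrimination.HilbertTensor A B), Orthonormal ℂ ψ →
        Module.finrank ℝ (LocalDiscrimination.associatedSpace f ψ) = 2 →
        LocalDiscrimination.DistinguishableByLOCC ψ) ∧
    (∀ ψ : Fin 2 → LocalDiscrimination.HilbertTensor A B, Orthonormal ℂ ψ →
        LocalDiscrimination.DistinguishableByLOCC ψ) :=
  ⟨fun f _ ψ hψ hdim => LocalDiscrimination.distinguishableByLOCC_of_finrank_eq_two f ψ hψ hdim,
    fun ψ hψ => LocalDiscrimination.distinguishableByLOCC_two ψ hψ⟩
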